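/- \textbf{Model.} Voters $1,\dots,N$ decide between alternatives $A$ and $B$. The state $\omega\in\{a,b\}$ equals $a$ with prior probability $\pi\in(0,1)$; the correct outcome is $A$ in state $a$ and $B$ in state $b$. Each voter $i$ privately observes her type $t_i=(p_i,q_i)\in\{A,B,I\}\times[\tfrac12,1]$, drawn from an arbitrary commonly known probability distribution $\tau_i$ (for instance a product $P_i\times Q_i$; atoms are allowed but not required), independently of the state and of the other voters' types, and a signal $s_i\in\{a,b\}$ with $\Pr(s_i=\omega\mid\omega,t)=q_i$, signals being independent across voters given $\omega$ and the types. A partisan ($p_i=A$ or $p_i=B$) gets payoff $1$ if her alternative $p_i$ wins and $0$ otherwise; an independent ($p_i=I$) gets $1$ if the correct outcome wins and $0$ otherwise. The alternative with more votes cast for it wins, ties being broken uniformly at random. \textbf{Voting systems.} A strategy of voter $i$ is a measurable map from types and signals to her available choices. Under liquid democracy she can vote for $A$, vote for $B$, abstain, or delegate to any voter $j\neq i$; delegation is transitive, and votes that end in a delegation cycle are cast in abstention. Under direct democracy she can vote for $A$, vote for $B$, or abstain. Under representative democracy there is a fixed, arbitrary set $\mathcal J$ of voters who, together with two mechanical representatives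 $a^*$ (always voting for $A$) and $b^*$ (always voting for $B$), act as representatives: a voter in $\mathcal J$ can vote for $A$, vote for $B$, or abstain; a voter outside $\mathcal J$ can abstain, or delegate to a member of $\mathcal J\cup\{a^*,b^*\}$. \textbf{Equilibria.} An equilibrium is a pure Bayes--Nash equilibrium in ex-ante strategies such that no voter's strategy is weakly dominated (in ex-ante expected utility, by another strategy, over all strategy profiles of the others) and every voter uses a threshold strategy: if two independent types of hers with different precisions make the same choice at a signal, then all her independent types with an intermediate precision make this choice at that signal. Equilibria are compared by information aggregation, i.e. the ex-ante probability that the correct outcome wins, or by welfare, i.e. the ex-ante probability that the majoritarian outcome wins. The majoritarian outcome is the alternative preferred ex post by more voters (an independent prefers the correct one); if equally many voters prefer each alternative, it is the correct outcome. A best equilibrium for a criterion is an equilibrium of the voting system that maximizes the criterion among all equilibria of that system. \textbf{Theorem.} Each of liquid democracy, direct democracy, and representative democracy (for every $\mathcal J$) has an equilibrium that is best for both criteria simultaneously. For each of the two criteria, a best equilibrium of liquid democracy is at least as good as a best equilibrium of direct democracy, and at least as good as a best equilibrium of representative democracy for every $\mathcal J$. -/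

import Mathlib

open MeasureTheory

namespace LiquidDemocracy

/-- A two-element set `{A, B}`. It is used for the two alternatives, for the two states of the
world (the state `a` in which alternative `A` is correct, and the state `b` in which `B` is
correct) and for the two signal realizations. -/
inductive Alt where
  | A
  | B
  deriving DecidableEq

instance : Fintype Alt := ⟨{.A, .B}, by intro c; cases c <;> simp⟩

/-- Preferences of a voter: a partisan for one alternative, or an independent. -/
inductive Pref where
  | partisan (c : Alt)
  | independent
  deriving DecidableEq

instance : MeasurableSpace Pref := ⊤

/-- Possible information precisions. -/
abbrev Precision : Type := Set.Icc (1 / 2 : ℝ) 1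

/-- A voter's type: a preference together with an information precision. -/
abbrev VType : Type := Pref × Precision

/-- The choices a voter may face: vote for an alternative, abstain, delegate to another voter,
or delegate to one of the two mechanical partisan representatives `a*` and `b*`. -/
inductive Ballot (n : ℕ) where
  | vote (c : Alt)
  | abstain
  | delegate (j : Fin n)
  | delegateStar (c : Alt)
  deriving DecidableEq

instance (n : ℕ) : MeasurableSpace (Ballot n) := ⊤

/-- The three voting systems; representative democracy comes with a fixed set `J` of voters who
act as representatives, besides `a*` and `b*`. -/
inductive Mechanism (n : ℕ) where
  | liquid
  | direct
  | representative (J : Finset (Fin n))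

/-- The choices available to voter `i` under a voting system. -/
def Mechanism.feasible {n : ℕ} : Mechanism n → Fin n → Set (Ballot n)
  | .liquid, i =>
      {y | (∃ c, y = .vote c) ∨ y = .abstain ∨ ∃ j, j ≠ i ∧ y = .delegate j}
  | .direct, _ =>
      {y | (∃ c, y = .vote c) ∨ y = .abstain}
  | .representative J, i =>
      {y | (i ∈ J ∧ ∃ c, y = .vote c) ∨ y = .abstain ∨
        (i ∉ J ∧ ((∃ j ∈ J, y = .delegate j) ∨ ∃ c, y = .delegateStar c))}

/-- A vote counted as `+1` for `A` and `-1` for `B`. -/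
def Alt.sign : Alt → ℤ
  | .A => 1
  | .B => -1

/-- Follow the chain of delegations that starts at voter `i`, looking at no more than `k` voters;
the result is the way in which `i`'s vote is finally cast (`+1` for `A`, `-1` for `B`, `0` for an
abstention). -/
def follow {n : ℕ} (y : Fin n → Ballot n) : ℕ → Fin n → ℤ
  | 0, _ => 0
  | k + 1, i =>
    match y i with
    | .vote c => c.sign
    | .abstain => 0
    | .delegate j => follow y k j
    | .delegateStar c => c.sign

/-- The number of votes for `A` minus the number of votes for `B`. A chain of delegations without
repetition has at most `n` voters, so a vote whose chain is not settled after `n` voters ends up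
in a delegation cycle, and is cast in abstention. (Votes that the mechanical
representatives `a*` and `b*` might hold of their own would cancel.) -/
def tally {n : ℕ} (y : Fin n → Ballot n) : ℤ := ∑ i, follow y n i

/-- The probability that alternative `c` wins, ties being broken uniformly at random. -/
noncomputable def winProb {n : ℕ} (y : Fin n → Ballot n) (c : Alt) : ℝ :=
  if tally y = 0 then 1 / 2 else if 0 < c.sign * tally y then 1 else 0

/-- The environment: the prior probability of the state `a`, and for each voter the
distribution of her type (preference and precision). Types are independent across voters. -/
structure Committee (n : ℕ) where
  prior : ℝ
  prior_pos : 0 < prior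
  prior_lt_one : prior < 1
  law : Fin n → ProbabilityMeasure VType

/-- Prior probability of a state. -/
def Committee.stateProb {n : ℕ} (C : Committee n) : Alt → ℝ
  | .A => C.prior
  | .B => 1 - C.prior

/-- Probability of the signal `s` in state `ω` for a voter of type `t`. -/
noncomputable def signalProb (t : VType) (ω s : Alt) : ℝ :=
  if s = ω then (t.2 : ℝ) else 1 - (t.2 : ℝ)

/-- Ex-ante (pure) strategies of voter `i`: for each type and signal, an available choice. -/
structure Strategy {n : ℕ} (M : Mechanism n) (i : Fin n) where
  act : VType → Alt → Ballot n
  measurable_act : ∀ s, Measurable fun t => act t s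
  act_feasible : ∀ t s, act t s ∈ M.feasible i

/-- Ex-ante strategy profiles. -/
abbrev Profile {n : ℕ} (M : Mechanism n) : Type := (i : Fin n) → Strategy M i

/-- Expected value of `g ω O`, where `ω` is the state and `O` the election outcome, when the
profile of types is `t` and the voters follow the interim strategies `σ`. Signals are independent
across voters given the state. -/
noncomputable def interimValue {n : ℕ} (C : Committee n) (σ : Fin n → Alt → Ballot n)
    (t : Fin n → VType) (g : Alt → Alt → ℝ) : ℝ :=
  ∑ ω, C.stateProb ω * ∑ s : Fin n → Alt, (∏ j, signalProb (t j) ω (s j)) *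
    ∑ o, winProb (fun j => σ j (s j)) o * g ω o

/-- Ex-ante expected value of `g t ω O`, where `t` is the profile of types, `ω` the state and `O`
the election outcome, when the voters follow the ex-ante strategy profile `S`. -/
noncomputable def exAnteValue {n : ℕ} (C : Committee n) {M : Mechanism n} (S : Profile M)
    (g : (Fin n → VType) → Alt → Alt → ℝ) : ℝ :=
  ∫ t, interimValue C (fun i => (S i).act (t i)) t (g t)
    ∂(Measure.pi fun i => (C.law i : Measure VType))

/-- The alternative that a voter with preference `p` prefers ex post in state `ω`. -/
def Pref.ideal : Pref → Alt → Alt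
  | .partisan c, _ => c
  | .independent, ω => ω

/-- Ex-post payoff of a voter with preference `p` from outcome `o` in state `ω`. -/
def payoff (p : Pref) (o ω : Alt) : ℝ := if o = p.ideal ω then 1 else 0

/-- Ex-ante expected utility of voter `i`. -/
noncomputable def EU {n : ℕ} (C : Committee n) {M : Mechanism n} (i : Fin n) (S : Profile M) :
    ℝ :=
  exAnteValue C S fun t ω o => payoff (t i).1 o ω

/-- Number of voters who prefer `c` ex post. -/
def support {n : ℕ} (t : Fin n → VType) (ω c : Alt) : ℕ :=
  (Finset.univ.filter fun i => (t i).1.ideal ω = c).card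

/-- The majoritarian outcome: the alternative that is preferred ex post by most voters. If both
alternatives have the same number of supporters, it is the correct alternative. -/
def majoritarian {n : ℕ} (t : Fin n → VType) (ω : Alt) : Alt :=
  if support t ω .B < support t ω .A then .A
  else if support t ω .A < support t ω .B then .B
  else ω

/-- The two measures by which voting systems are compared: information aggregation (the
probability of the correct outcome) and welfare (the probability of the majoritarian outcome). -/
inductive Criterion where
  | informationAggregation
  | welfare

/-- Ex-ante probability that the correct outcome, respectively the majoritarian outcome, is
implemented. -/
noncomputable def performance {n : ℕ} (C : Committee n) {M : Mechanism n} :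
    Criterion → Profile M → ℝ
  | .informationAggregation, S => exAnteValue C S fun _ ω o => if o = ω then 1 else 0
  | .welfare, S => exAnteValue C S fun t ω o => if o = majoritarian t ω then 1 else 0

/-- Bayes-Nash equilibrium in ex-ante strategies. -/
def IsBayesNash {n : ℕ} (C : Committee n) {M : Mechanism n} (S : Profile M) : Prop :=
  ∀ (i : Fin n) (d : Strategy M i), EU C i (Function.update S i d) ≤ EU C i S

/-- The strategy `d'` of voter `i` weakly dominates the strategy `d`. -/
def WeaklyDominates {n : ℕ} (C : Committee n) {M : Mechanism n} {i : Fin n}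
    (d' d : Strategy M i) : Prop :=
  (∀ S : Profile M, EU C i (Function.update S i d) ≤ EU C i (Function.update S i d')) ∧
    ∃ S : Profile M, EU C i (Function.update S i d) < EU C i (Function.update S i d')

/-- Threshold strategies: if two independent types with different precisions make the same
choice at a signal, so do all independent types with an intermediate precision. -/
def IsThreshold {n : ℕ} {M : Mechanism n} {i : Fin n} (d : Strategy M i) : Prop :=
  ∀ (s : Alt) (y : Ballot n), {q : Precision | d.act (.independent, q) s = y}.OrdConnected

/-- Equilibria: pure Bayes-Nash equilibria in undominated threshold strategies. -/
structure IsEquilibrium {n : ℕ} (C : Committee n) {M : Mechanism n} (S : Profile M) : Prop where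
  bayesNash : IsBayesNash C S
  undominated : ∀ i, ¬ ∃ d : Strategy M i, WeaklyDominates C d (S i)
  threshold : ∀ i, IsThreshold (S i)

/-- A best equilibrium of a voting system with respect to a criterion. -/
def IsBestEquilibrium {n : ℕ} (C : Committee n) {M : Mechanism n} (W : Criterion)
    (S : Profile M) : Prop :=
  IsEquilibrium C S ∧ ∀ S' : Profile M, IsEquilibrium C S' → performance C W S' ≤ performance C W S

end LiquidDemocracy

open LiquidDemocracy

namespace LiquidDemocracy

/-! ### Finiteness and measurability -/

/-! Call a strategy sincere if partisans always use the ballot that counts for their own alternative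
whatever the others do. The theorem reduces to maximizing the probability of the correct outcome
over sincere profiles.

Making a strategy sincere never hurts its owner (`EU_le_sincerify`), and undominated strategies are
almost surely sincere already (`ae_act_eq_sincerify`). Between sincere strategies, a voter's utility
changes exactly as the probability of the correct outcome does (`EU_sub_EU_of_isSincere`). This
common potential makes every sincere maximizer a Bayes–Nash equilibrium. On sincere profiles welfare
is the same objective plus a constant (`performance_welfare`), so one maximizer is best for both
criteria.

A maximizer exists because the objective is multilinear in the voters' finite-dimensional ballot
distributions: it has a maximum on the compact closure, and pure best responses, inserted voter by
voter, make it attained (`exists_correctProb_max`). Responses chosen lexicographically, with ties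
broken by a finite family spanning all possible objectives, are also undominated and of threshold
form (`exists_undominated_response`).

Finally, sincere profiles of the other systems can be copied under liquid democracy with the same
outcomes (`performance_toLiquid`), so its maximum is at least as large. -/

instance : DiscreteMeasurableSpace Pref := ⟨fun _ => trivial⟩

instance (n : ℕ) : DiscreteMeasurableSpace (Ballot n) := ⟨fun _ => trivial⟩

instance : Finite Pref :=
  Finite.of_surjective (fun o : Option Alt => o.elim Pref.independent Pref.partisan) fun p => by
    cases p with
    | partisan c => exact ⟨some c, rfl⟩
    | independent => exact ⟨none, rfl⟩

instance (n : ℕ) : Finite (Ballot n) :=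
  Finite.of_surjective
    (fun o : Option (Alt ⊕ Fin n ⊕ Alt) => o.elim Ballot.abstain
      (Sum.elim Ballot.vote (Sum.elim Ballot.delegate Ballot.delegateStar))) fun y => by
    cases y with
    | vote c => exact ⟨some (.inl c), rfl⟩
    | abstain => exact ⟨none, rfl⟩
    | delegate j => exact ⟨some (.inr (.inl j)), rfl⟩
    | delegateStar c => exact ⟨some (.inr (.inr c)), rfl⟩

noncomputable instance (n : ℕ) : Fintype (Ballot n) := Fintype.ofFinite _

theorem sum_alt {M : Type*} [AddCommMonoid M] (f : Alt → M) : ∑ c, f c = f .A + f .B := by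
  have : (Finset.univ : Finset Alt) = {.A, .B} := rfl
  rw [this, Finset.sum_pair (by simp)]

/-- The type distribution of the committee. -/
noncomputable abbrev Committee.typeLaw {n : ℕ} (C : Committee n) : Measure (Fin n → VType) :=
  Measure.pi fun i => (C.law i : Measure VType)

theorem Committee.stateProb_pos {n : ℕ} (C : Committee n) (ω : Alt) : 0 < C.stateProb ω := by
  have h1 := C.prior_pos
  have h2 := C.prior_lt_one
  cases ω <;> simp only [Committee.stateProb] <;> linarith

theorem signalProb_nonneg (t : VType) (ω s : Alt) : 0 ≤ signalProb t ω s := by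
  have h1 := t.2.2.1
  have h2 := t.2.2.2
  unfold signalProb
  split_ifs <;> linarith

theorem signalProb_le_one (t : VType) (ω s : Alt) : signalProb t ω s ≤ 1 := by
  have h1 := t.2.2.1
  have h2 := t.2.2.2
  unfold signalProb
  split_ifs <;> linarith

theorem signalProb_self_pos (t : VType) (ω : Alt) : 0 < signalProb t ω ω := by
  have h1 := t.2.2.1
  simp only [signalProb, if_true]
  linarith

theorem sum_signalProb (t : VType) (ω : Alt) : ∑ s, signalProb t ω s = 1 := by
  cases ω <;> simp [sum_alt, signalProb]

theorem measurable_signalProb (ω s : Alt) : Measurable fun t : VType => signalProb t ω s := by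
  unfold signalProb
  split_ifs
  · exact measurable_subtype_coe.comp measurable_snd
  · exact measurable_const.sub (measurable_subtype_coe.comp measurable_snd)

/-- The other element of `{A, B}`. -/
def Alt.other : Alt → Alt
  | .A => .B
  | .B => .A

theorem Alt.eq_other {c d : Alt} (h : c ≠ d) : d = c.other := by
  cases c <;> cases d <;> simp_all [Alt.other]

theorem Alt.sign_mul_self (c : Alt) : c.sign * c.sign = 1 := by cases c <;> rfl

/-! ### Outcomes -/

section Outcome

variable {n : ℕ}

theorem winProb_nonneg (y : Fin n → Ballot n) (c : Alt) : 0 ≤ winProb y c := by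
  unfold winProb
  split_ifs <;> norm_num

theorem winProb_le_one (y : Fin n → Ballot n) (c : Alt) : winProb y c ≤ 1 := by
  unfold winProb
  split_ifs <;> norm_num

theorem sum_winProb (y : Fin n → Ballot n) : ∑ o, winProb y o = 1 := by
  rw [sum_alt]
  simp only [winProb, Alt.sign, one_mul, neg_mul, Left.neg_pos_iff]
  split_ifs <;> first | omega | norm_num

theorem winProb_eq_one_iff (y : Fin n → Ballot n) (c : Alt) :
    winProb y c = 1 ↔ 0 < c.sign * tally y := by
  unfold winProb
  split_ifs with h1 h2
  · simp [h1]
  · simp [h2]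
  · simp [h2]

theorem winProb_mono {y y' : Fin n → Ballot n} {c : Alt}
    (h : c.sign * tally y ≤ c.sign * tally y') : winProb y c ≤ winProb y' c := by
  unfold winProb
  cases c <;> simp only [Alt.sign, one_mul, neg_mul, Left.neg_pos_iff] at h ⊢ <;>
    split_ifs <;> first | omega | norm_num

theorem abs_follow_le_one (y : Fin n → Ballot n) (k : ℕ) (i : Fin n) : |follow y k i| ≤ 1 := by
  induction k generalizing i with
  | zero => simp [follow]
  | succ k ih =>
    rw [follow]
    split
    · rename_i c _; cases c <;> simp [Alt.sign]
    · simp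
    · exact ih _
    · rename_i c _; cases c <;> simp [Alt.sign]

theorem sign_mul_follow_le_one (y : Fin n → Ballot n) (k : ℕ) (i : Fin n) (c : Alt) :
    c.sign * follow y k i ≤ 1 := by
  have := abs_le.1 (abs_follow_le_one y k i)
  cases c <;> simp only [Alt.sign] <;> omega

theorem neg_one_le_sign_mul_follow (y : Fin n → Ballot n) (k : ℕ) (i : Fin n) (c : Alt) :
    -1 ≤ c.sign * follow y k i := by
  have := abs_le.1 (abs_follow_le_one y k i)
  cases c <;> simp only [Alt.sign] <;> omega

/-- A ballot that is cast for `c` irrespective of the ballots of the others. -/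
def Ballot.IsFor (c : Alt) (b : Ballot n) : Prop := b = .vote c ∨ b = .delegateStar c

theorem follow_of_isFor {y : Fin n → Ballot n} {i : Fin n} {c : Alt} (h : (y i).IsFor c) (k : ℕ) :
    follow y (k + 1) i = c.sign := by
  rcases h with h | h <;> simp [follow, h]

/-- Only chains passing through `i` are affected, and these now end in the most favorable value for
`c`. -/
theorem follow_update_isFor (y : Fin n → Ballot n) (i : Fin n) {c : Alt} {b : Ballot n}
    (hb : b.IsFor c) (k : ℕ) (j : Fin n) :
    c.sign * follow y k j ≤ c.sign * follow (Function.update y i b) k j := by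
  induction k generalizing j with
  | zero => simp [follow]
  | succ k ih =>
    by_cases hj : j = i
    · subst hj
      rw [follow_of_isFor (y := Function.update y j b) (c := c) (by simpa using hb),
        Alt.sign_mul_self]
      exact sign_mul_follow_le_one _ _ _ _
    · rw [follow, follow, Function.update_of_ne hj]
      split
      · exact le_rfl
      · exact le_rfl
      · exact ih _
      · exact le_rfl

theorem winProb_le_update_isFor (y : Fin n → Ballot n) (i : Fin n) {c : Alt} {b : Ballot n}
    (hb : b.IsFor c) : winProb y c ≤ winProb (Function.update y i b) c := by
  apply winProb_mono
  unfold tally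
  rw [Finset.mul_sum, Finset.mul_sum]
  exact Finset.sum_le_sum fun j _ => follow_update_isFor y i hb n j

theorem follow_abstain_update (i : Fin n) (b : Ballot n) (k : ℕ) {j : Fin n} (hj : j ≠ i) :
    follow (Function.update (fun _ => Ballot.abstain) i b) k j = 0 := by
  cases k <;> simp [follow, hj]

theorem tally_abstain_update (i : Fin n) (b : Ballot n) :
    tally (Function.update (fun _ => Ballot.abstain) i b) =
      follow (Function.update (fun _ => Ballot.abstain) i b) n i := by
  unfold tally
  exact Finset.sum_eq_single i (fun j _ hj => follow_abstain_update i b n hj) (by simp)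

/-- When all others abstain, a delegated vote is lost and produces a tie. This profile therefore
separates sincere ballots from all other available ones. -/
theorem winProb_abstain_update_lt_one {i : Fin n} {c : Alt} {b : Ballot n} (hb : ¬ b.IsFor c)
    (hi : b ≠ .delegate i) :
    winProb (Function.update (fun _ => Ballot.abstain) i b) c < 1 := by
  refine lt_of_le_of_ne (winProb_le_one _ _) ?_
  rw [Ne, winProb_eq_one_iff, tally_abstain_update]
  -- `follow` reads a ballot only with positive fuel; the existence of voter `i` guarantees it.
  obtain ⟨m, rfl⟩ : ∃ m, n = m + 1 := ⟨n - 1, by have := i.pos; omega⟩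
  rw [follow, Function.update_self]
  cases b with
  | vote d =>
    have : c ≠ d := fun h => hb (Or.inl (by rw [h]))
    cases c <;> cases d <;> simp_all [Alt.sign]
  | abstain => simp
  | delegate j =>
    have : j ≠ i := fun h => hi (by rw [h])
    simp [follow_abstain_update i _ _ this]
  | delegateStar d =>
    have : c ≠ d := fun h => hb (Or.inr (by rw [h]))
    cases c <;> cases d <;> simp_all [Alt.sign]

theorem winProb_abstain_update_isFor {i : Fin n} {c : Alt} {b : Ballot n} (hb : b.IsFor c) :
    winProb (Function.update (fun _ => Ballot.abstain) i b) c = 1 := by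
  rw [winProb_eq_one_iff, tally_abstain_update]
  obtain ⟨m, rfl⟩ : ∃ m, n = m + 1 := ⟨n - 1, by have := i.pos; omega⟩
  rw [follow_of_isFor (c := c) (by simpa using hb), Alt.sign_mul_self]
  exact one_pos

end Outcome

/-! ### Interim values -/

section Interim

variable {n : ℕ} (C : Committee n)

/-- Probability of a signal profile, given the state and the type profile. -/
noncomputable def signalWeight (t : Fin n → VType) (ω : Alt) (s : Fin n → Alt) : ℝ :=
  ∏ j, signalProb (t j) ω (s j)

theorem signalWeight_nonneg (t : Fin n → VType) (ω : Alt) (s : Fin n → Alt) :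
    0 ≤ signalWeight t ω s :=
  Finset.prod_nonneg fun _ _ => signalProb_nonneg _ _ _

theorem signalWeight_le_one (t : Fin n → VType) (ω : Alt) (s : Fin n → Alt) :
    signalWeight t ω s ≤ 1 :=
  Finset.prod_le_one (fun _ _ => signalProb_nonneg _ _ _) fun _ _ => signalProb_le_one _ _ _

theorem sum_signalWeight (t : Fin n → VType) (ω : Alt) : ∑ s, signalWeight t ω s = 1 := by
  have := Finset.prod_univ_sum (fun _ : Fin n => (Finset.univ : Finset Alt))
    fun j s => signalProb (t j) ω s
  simp only [sum_signalProb, Finset.prod_const_one, Fintype.piFinset_univ] at this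
  exact this.symm

theorem measurable_signalWeight (ω : Alt) (s : Fin n → Alt) :
    Measurable fun t : Fin n → VType => signalWeight t ω s :=
  Finset.measurable_prod _ fun j _ => (measurable_signalProb ω (s j)).comp (measurable_pi_apply j)

theorem interimValue_eq (σ : Fin n → Alt → Ballot n) (t : Fin n → VType) (g : Alt → Alt → ℝ) :
    interimValue C σ t g = ∑ ω, C.stateProb ω * ∑ s : Fin n → Alt, signalWeight t ω s *
      ∑ o, winProb (fun j => σ j (s j)) o * g ω o := rfl

theorem interimValue_mono {σ σ' : Fin n → Alt → Ballot n} {t : Fin n → VType}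
    {g g' : Alt → Alt → ℝ}
    (h : ∀ ω (s : Fin n → Alt), ∑ o, winProb (fun j => σ j (s j)) o * g ω o ≤
      ∑ o, winProb (fun j => σ' j (s j)) o * g' ω o) :
    interimValue C σ t g ≤ interimValue C σ' t g' := by
  rw [interimValue_eq, interimValue_eq]
  exact Finset.sum_le_sum fun ω _ => mul_le_mul_of_nonneg_left
    (Finset.sum_le_sum fun s _ => mul_le_mul_of_nonneg_left (h ω s) (signalWeight_nonneg _ _ _))
    (C.stateProb_pos ω).le

variable {M : Mechanism n}

theorem measurable_winProb_act (S : Profile M) (s : Fin n → Alt) (o : Alt) :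
    Measurable fun t : Fin n → VType => winProb (fun j => (S j).act (t j) (s j)) o :=
  (Measurable.of_discrete (f := fun y : Fin n → Ballot n => winProb y o)).comp <|
    measurable_pi_lambda _ fun j => ((S j).measurable_act (s j)).comp (measurable_pi_apply j)

theorem integrable_interimValue (S : Profile M) {g : (Fin n → VType) → Alt → Alt → ℝ}
    (hm : ∀ ω o, Measurable fun t => g t ω o) (hb : ∀ t ω o, |g t ω o| ≤ 1) :
    Integrable (fun t => interimValue C (fun i => (S i).act (t i)) t (g t)) C.typeLaw := by
  simp only [interimValue_eq]
  refine integrable_finsetSum _ fun ω _ => (integrable_finsetSum _ fun s _ => ?_).const_mul _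
  simp only [Finset.mul_sum]
  refine integrable_finsetSum _ fun o _ => Integrable.of_bound
    ((measurable_signalWeight ω s).mul
      ((measurable_winProb_act S s o).mul (hm ω o))).aestronglyMeasurable 1
    (Filter.Eventually.of_forall fun t => ?_)
  rw [Real.norm_eq_abs, abs_mul, abs_mul, abs_of_nonneg (signalWeight_nonneg _ _ _),
    abs_of_nonneg (winProb_nonneg _ _)]
  exact mul_le_one₀ (signalWeight_le_one _ _ _) (mul_nonneg (winProb_nonneg _ _) (abs_nonneg _))
    (mul_le_one₀ (winProb_le_one _ _) (abs_nonneg _) (hb t ω o))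

theorem measurable_pref (i : Fin n) : Measurable fun t : Fin n → VType => (t i).1 :=
  measurable_fst.comp (measurable_pi_apply i)

theorem integrable_interimValue_payoff (S : Profile M) (i : Fin n) :
    Integrable (fun t => interimValue C (fun j => (S j).act (t j)) t
      fun ω o => payoff (t i).1 o ω) C.typeLaw := by
  refine integrable_interimValue C S
    (fun ω o => (Measurable.of_discrete (f := fun p : Pref => payoff p o ω)).comp
      (measurable_pref i)) fun t ω o => ?_
  unfold payoff
  split_ifs <;> simp

theorem integrable_interimValue_correct (S : Profile M) :
    Integrable (fun t => interimValue C (fun j => (S j).act (t j)) t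
      fun ω o => if o = ω then 1 else 0) C.typeLaw := by
  refine integrable_interimValue C S (g := fun _ ω o => if o = ω then 1 else 0)
    (fun ω o => measurable_const) fun t ω o => ?_
  split_ifs <;> simp

theorem sum_winProb_correct (y : Fin n → Ballot n) (c : Alt) :
    ∑ o, winProb y o * (if o = c then 1 else 0) = winProb y c := by simp

theorem sum_winProb_payoff (y : Fin n → Ballot n) (p : Pref) (ω : Alt) :
    ∑ o, winProb y o * payoff p o ω = winProb y (p.ideal ω) := by simp [payoff]

end Interim

/-! ### Sincere strategies -/

section Sincere

variable {n : ℕ} {M : Mechanism n}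

/-- The available choice by which a vote is cast for `c` irrespective of the other voters. -/
def Mechanism.sincereBallot : Mechanism n → Fin n → Alt → Ballot n
  | .liquid, _, c => .vote c
  | .direct, _, c => .vote c
  | .representative J, i, c => if i ∈ J then .vote c else .delegateStar c

theorem Mechanism.sincereBallot_isFor (M : Mechanism n) (i : Fin n) (c : Alt) :
    (M.sincereBallot i c).IsFor c := by
  cases M with
  | liquid => exact Or.inl rfl
  | direct => exact Or.inl rfl
  | representative J =>
    by_cases h : i ∈ J
    · exact Or.inl (if_pos h)
    · exact Or.inr (if_neg h)

theorem Mechanism.sincereBallot_mem (M : Mechanism n) (i : Fin n) (c : Alt) :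
    M.sincereBallot i c ∈ M.feasible i := by
  cases M with
  | liquid => simp [sincereBallot, feasible]
  | direct => simp [sincereBallot, feasible]
  | representative J => by_cases h : i ∈ J <;> simp [sincereBallot, feasible, h]

/-- No system offers a voter both a direct vote and a mechanical representative, so the
unconditional ballot for `c` is unique. -/
theorem Mechanism.eq_sincereBallot {i : Fin n} {c : Alt} {b : Ballot n} (h : b ∈ M.feasible i)
    (hb : b.IsFor c) : b = M.sincereBallot i c := by
  rcases hb with rfl | rfl <;> cases M <;> simp_all [sincereBallot, feasible]

theorem Mechanism.abstain_mem (M : Mechanism n) (i : Fin n) : Ballot.abstain ∈ M.feasible i := by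
  cases M <;> simp [feasible]

theorem Mechanism.ne_delegate_self {i : Fin n} {b : Ballot n} (h : b ∈ M.feasible i) :
    b ≠ .delegate i := by
  rintro rfl
  cases M <;> simp_all [feasible]

/-- The strategy of always abstaining. -/
def abstention (M : Mechanism n) (i : Fin n) : Strategy M i where
  act _ _ := .abstain
  measurable_act _ := measurable_const
  act_feasible _ _ := M.abstain_mem i

/-- The strategy by which partisans vote for their alternative and independents follow `f`. -/
def sincereStrategy {i : Fin n} (f : Precision → Alt → Ballot n)
    (hf : ∀ s, Measurable fun q => f q s) (hM : ∀ q s, f q s ∈ M.feasible i) : Strategy M i where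
  act t s := match t.1 with
    | .partisan c => M.sincereBallot i c
    | .independent => f t.2 s
  measurable_act s := measurable_from_prod_countable_right fun p => by
    cases p with
    | partisan c => exact measurable_const
    | independent => exact hf s
  act_feasible t s := by
    cases h : t.1 with
    | partisan c => exact M.sincereBallot_mem i c
    | independent => exact hM t.2 s

/-- Partisans always vote for their alternative. -/
def IsSincere {i : Fin n} (d : Strategy M i) : Prop :=
  ∀ c q s, d.act (.partisan c, q) s = M.sincereBallot i c

/-- The strategy `d` with sincere behavior of partisans. -/
def sincerify {i : Fin n} (d : Strategy M i) : Strategy M i :=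
  sincereStrategy (fun q s => d.act (.independent, q) s)
    (fun s => (d.measurable_act s).comp measurable_prodMk_left) fun _ _ => d.act_feasible _ _

theorem isSincere_sincerify {i : Fin n} (d : Strategy M i) : IsSincere (sincerify d) :=
  fun _ _ _ => rfl

theorem IsSincere.act_eq {i : Fin n} {d d' : Strategy M i} (hd : IsSincere d) (hd' : IsSincere d')
    {t : VType} (ht : t.1 ≠ .independent) (s : Alt) : d.act t s = d'.act t s := by
  obtain ⟨p, q⟩ := t
  cases p with
  | partisan c => rw [hd, hd']
  | independent => exact absurd rfl ht

theorem act_update (S : Profile M) (i : Fin n) (d : Strategy M i) (t : Fin n → VType)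
    (s : Fin n → Alt) :
    (fun j => ((Function.update S i d) j).act (t j) (s j)) =
      Function.update (fun j => (S j).act (t j) (s j)) i (d.act (t i) (s i)) := by
  funext j
  by_cases h : j = i
  · subst h; simp
  · simp [h]

variable (C : Committee n)

theorem sum_payoff_le_sincerify (S : Profile M) (i : Fin n) (d : Strategy M i)
    (t : Fin n → VType) (ω : Alt) (s : Fin n → Alt) :
    ∑ o, winProb (fun j => (Function.update S i d j).act (t j) (s j)) o * payoff (t i).1 o ω ≤
      ∑ o, winProb (fun j => (Function.update S i (sincerify d) j).act (t j) (s j)) o *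
        payoff (t i).1 o ω := by
  rw [sum_winProb_payoff, sum_winProb_payoff, act_update, act_update]
  rcases ht : t i with ⟨p, q⟩
  cases p with
  | partisan c =>
    have := winProb_le_update_isFor (Function.update (fun j => (S j).act (t j) (s j)) i
      (d.act (.partisan c, q) (s i))) i (M.sincereBallot_isFor i c)
    rw [Function.update_idem] at this
    exact this
  | independent => exact le_rfl

theorem EU_le_sincerify (S : Profile M) (i : Fin n) (d : Strategy M i) :
    EU C i (Function.update S i d) ≤ EU C i (Function.update S i (sincerify d)) :=
  integral_mono (integrable_interimValue_payoff C _ i) (integrable_interimValue_payoff C _ i)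
    fun t => interimValue_mono C fun ω s => sum_payoff_le_sincerify S i d t ω s

/-- The two strategies can differ only when the voter is independent, and then her payoff is the
indicator of the correct outcome. -/
theorem EU_sub_EU_of_isSincere (S : Profile M) (i : Fin n) {d d' : Strategy M i}
    (hd : IsSincere d) (hd' : IsSincere d') :
    EU C i (Function.update S i d') - EU C i (Function.update S i d) =
      performance C .informationAggregation (Function.update S i d') -
        performance C .informationAggregation (Function.update S i d) := by
  unfold EU performance exAnteValue
  rw [← integral_sub (integrable_interimValue_payoff C _ i) (integrable_interimValue_payoff C _ i),
    ← integral_sub (integrable_interimValue_correct C _) (integrable_interimValue_correct C _)]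
  refine integral_congr_ae (Filter.Eventually.of_forall fun t => ?_)
  simp only [interimValue_eq, act_update, sum_winProb_payoff, sum_winProb_correct]
  by_cases ht : (t i).1 = .independent
  · simp only [ht, Pref.ideal]
  · simp only [hd.act_eq hd' ht, sub_self]

/-! ### Undominated strategies are almost surely sincere -/

/-- Against universal abstention the sincere version must not gain, or it would dominate. The
interim values are ordered pointwise, so they agree almost everywhere, which an insincere partisan
ballot would contradict. -/
theorem ae_act_eq_sincerify {i : Fin n} {d : Strategy M i}
    (h : ¬ ∃ d' : Strategy M i, WeaklyDominates C d' d) :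
    ∀ᵐ t ∂C.typeLaw, ∀ s, d.act (t i) s = (sincerify d).act (t i) s := by
  have heq : EU C i (Function.update (abstention M) i d) =
      EU C i (Function.update (abstention M) i (sincerify d)) := by
    by_contra hne
    exact h ⟨sincerify d, fun S => EU_le_sincerify C S i d, abstention M,
      lt_of_le_of_ne (EU_le_sincerify C _ i d) hne⟩
  have hle : ∀ (t : Fin n → VType) (ω : Alt) (s : Fin n → Alt), _ :=
    sum_payoff_le_sincerify (abstention M) i d
  have hae := (integral_eq_iff_of_ae_le (integrable_interimValue_payoff C _ i)
    (integrable_interimValue_payoff C _ i)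
    (Filter.Eventually.of_forall fun t => interimValue_mono C fun ω s => hle t ω s)).1 heq
  filter_upwards [hae] with t ht s₀
  by_contra hne
  refine ne_of_lt ?_ ht
  simp only [interimValue_eq]
  -- Strictness is tested where the state and all signals equal `s₀`: this has positive weight since
  -- precisions are at least one half, whereas a wrong signal may have probability zero.
  refine Finset.sum_lt_sum (fun ω _ => mul_le_mul_of_nonneg_left
    (Finset.sum_le_sum fun s _ => mul_le_mul_of_nonneg_left (hle t ω s)
      (signalWeight_nonneg _ _ _)) (C.stateProb_pos ω).le) ⟨s₀, Finset.mem_univ _, ?_⟩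
  refine mul_lt_mul_of_pos_left (Finset.sum_lt_sum (fun s _ => mul_le_mul_of_nonneg_left
    (hle t s₀ s) (signalWeight_nonneg _ _ _)) ⟨fun _ => s₀, Finset.mem_univ _, ?_⟩)
    (C.stateProb_pos _)
  refine mul_lt_mul_of_pos_left ?_ (Finset.prod_pos fun j _ => signalProb_self_pos _ _)
  rw [sum_winProb_payoff, sum_winProb_payoff, act_update, act_update]
  have hfeas := d.act_feasible (t i) s₀
  rcases htp : t i with ⟨p, q⟩
  rw [htp] at hne hfeas
  cases p with
  | partisan c =>
    refine lt_of_lt_of_eq (winProb_abstain_update_lt_one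
      (fun hb => hne (Mechanism.eq_sincereBallot hfeas hb)) (Mechanism.ne_delegate_self hfeas)) ?_
    exact (winProb_abstain_update_isFor (M.sincereBallot_isFor i c)).symm
  | independent => exact absurd rfl hne

theorem performance_sincerify {S : Profile M} (hS : IsEquilibrium C S) (W : Criterion) :
    performance C W (fun i => sincerify (S i)) = performance C W S := by
  have hae : ∀ᵐ t ∂C.typeLaw, ∀ i s, (S i).act (t i) s = (sincerify (S i)).act (t i) s :=
    ae_all_iff.2 fun i => ae_act_eq_sincerify C (hS.undominated i)
  cases W <;> unfold performance exAnteValue <;> refine integral_congr_ae ?_ <;>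
    filter_upwards [hae] with t ht <;> simp only [interimValue_eq, ht]

/-! ### Welfare and information aggregation -/

theorem measurable_support (ω c : Alt) : Measurable fun t : Fin n → VType => support t ω c :=
  (Measurable.of_discrete (f := fun P : Fin n → Pref =>
    (Finset.univ.filter fun i => (P i).ideal ω = c).card)).comp
      (measurable_pi_lambda _ measurable_pref)

theorem measurable_majoritarian (ω : Alt) :
    Measurable[_, ⊤] fun t : Fin n → VType => majoritarian t ω := by
  unfold majoritarian
  exact Measurable.ite (measurableSet_lt (measurable_support _ _) (measurable_support _ _))
    measurable_const (Measurable.ite (measurableSet_lt (measurable_support _ _)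
      (measurable_support _ _)) measurable_const measurable_const)

theorem support_other_lt {t : Fin n → VType} {ω : Alt} (h : majoritarian t ω ≠ ω) :
    support t ω ω < support t ω (majoritarian t ω) := by
  unfold majoritarian at h ⊢
  cases ω <;> split_ifs at h ⊢ <;> simp_all

theorem ideal_eq_of_ne {p : Pref} {ω c : Alt} (hc : c ≠ ω) (h : p.ideal ω = c) :
    p = .partisan c := by
  cases p with
  | partisan d => exact congrArg _ h
  | independent => exact absurd h.symm hc

/-- Ties favor the correct outcome, so an incorrect majoritarian outcome has a strict majority of
supporters, all of them partisans. Each contributes one vote to it, and every other voter can cancel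
at most one. -/
theorem winProb_majoritarian {S : Profile M} (hS : ∀ i, IsSincere (S i)) {t : Fin n → VType}
    {ω : Alt} (h : majoritarian t ω ≠ ω) (s : Fin n → Alt) :
    winProb (fun j => (S j).act (t j) (s j)) (majoritarian t ω) = 1 := by
  rw [winProb_eq_one_iff]
  have hlt := support_other_lt h
  set c := majoritarian t ω with hc
  set y := fun j => (S j).act (t j) (s j) with hy
  have hle : ∑ i, (if (t i).1.ideal ω = c then (1 : ℤ) else -1) ≤ c.sign * tally y := by
    rw [tally, Finset.mul_sum]
    refine Finset.sum_le_sum fun i _ => ?_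
    split_ifs with hi
    · obtain ⟨m, hm⟩ : ∃ m, n = m + 1 := ⟨n - 1, by have := i.pos; omega⟩
      have hb : (y i).IsFor c := by
        have hp := ideal_eq_of_ne h hi
        have : y i = M.sincereBallot i c := by
          have := hS i c (t i).2 (s i)
          rw [← this, ← hp]
        rw [this]
        exact M.sincereBallot_isFor i c
      have : ∀ k, k = m + 1 → c.sign * follow y k i = 1 := by
        rintro k rfl
        rw [follow_of_isFor hb, Alt.sign_mul_self]
      exact (this n hm).ge
    · exact neg_one_le_sign_mul_follow _ _ _ _
  refine lt_of_lt_of_le ?_ hle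
  have hω : ∀ i, (t i).1.ideal ω = ω ↔ ¬ (t i).1.ideal ω = c := fun i =>
    ⟨fun h1 h2 => h (h2.symm.trans h1), fun h1 => by
      rw [Alt.eq_other (Ne.symm h1), ← Alt.eq_other h]⟩
  unfold support at hlt
  simp only [hω] at hlt
  rw [Finset.sum_ite]
  simp only [Finset.sum_const, nsmul_eq_mul, mul_one, mul_neg]
  omega

/-- Ex-ante probability that the majoritarian outcome is incorrect. -/
noncomputable def incorrectProb : ℝ :=
  ∫ t, ∑ ω, C.stateProb ω * (if majoritarian t ω = ω then 0 else 1) ∂C.typeLaw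

theorem integrable_interimValue_majoritarian (S : Profile M) :
    Integrable (fun t => interimValue C (fun j => (S j).act (t j)) t
      fun ω o => if o = majoritarian t ω then 1 else 0) C.typeLaw := by
  refine integrable_interimValue C S (fun ω o => Measurable.ite ?_ measurable_const
    measurable_const) fun t ω o => ?_
  · have := measurable_majoritarian (n := n) ω (MeasurableSpace.measurableSet_top (s := {o}))
    convert this using 1
    ext t
    exact eq_comm
  · split_ifs <;> simp

/-- The criteria differ only where the majoritarian outcome is incorrect. There it wins surely, and
the probability of this event does not depend on the profile. -/
theorem performance_welfare {S : Profile M} (hS : ∀ i, IsSincere (S i)) :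
    performance C .welfare S = performance C .informationAggregation S + incorrectProb C := by
  rw [← sub_eq_iff_eq_add']
  unfold performance exAnteValue incorrectProb
  rw [← integral_sub (integrable_interimValue_majoritarian C S)
    (integrable_interimValue_correct C S)]
  refine integral_congr_ae (Filter.Eventually.of_forall fun t => ?_)
  simp only [interimValue_eq, sum_winProb_correct]
  rw [← Finset.sum_sub_distrib]
  refine Finset.sum_congr rfl fun ω _ => ?_
  rw [← mul_sub, ← Finset.sum_sub_distrib]
  congr 1
  by_cases h : majoritarian t ω = ω
  · simp [h]
  · rw [if_neg h, ← sum_signalWeight t ω]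
    refine Finset.sum_congr rfl fun s _ => ?_
    have h1 := winProb_majoritarian hS h s
    have h2 := sum_winProb fun j => (S j).act (t j) (s j)
    rw [← mul_sub, h1]
    have h3 : winProb (fun j => (S j).act (t j) (s j)) ω = 0 := by
      rw [sum_alt] at h2
      revert h h1
      cases ω <;> cases majoritarian t _ <;> simp <;> intro h1 <;> linarith
    rw [h3, sub_zero, mul_one]

/-! ### Embedding into liquid democracy -/

/-- Replace delegation to a mechanical representative by the corresponding vote. -/
def Ballot.toLiquid : Ballot n → Ballot n
  | .vote c => .vote c
  | .abstain => .abstain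
  | .delegate j => .delegate j
  | .delegateStar c => .vote c

theorem follow_toLiquid (y : Fin n → Ballot n) (k : ℕ) (i : Fin n) :
    follow (fun j => (y j).toLiquid) k i = follow y k i := by
  induction k generalizing i with
  | zero => rfl
  | succ k ih => rw [follow, follow]; cases y i <;> first | rfl | exact ih _

theorem winProb_toLiquid (y : Fin n → Ballot n) (c : Alt) :
    winProb (fun j => (y j).toLiquid) c = winProb y c := by
  have h : tally (fun j => (y j).toLiquid) = tally y := by simp only [tally, follow_toLiquid]
  unfold winProb
  rw [h]

theorem toLiquid_mem {i : Fin n} {b : Ballot n} (h : b ∈ M.feasible i) :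
    b.toLiquid ∈ (Mechanism.liquid (n := n)).feasible i := by
  have := Mechanism.ne_delegate_self h
  cases b <;> simp_all [Ballot.toLiquid, Mechanism.feasible]

/-- The strategy under liquid democracy with the same effect. -/
def Strategy.toLiquid {i : Fin n} (d : Strategy M i) : Strategy (Mechanism.liquid (n := n)) i where
  act t s := (d.act t s).toLiquid
  measurable_act s := (Measurable.of_discrete (f := Ballot.toLiquid)).comp (d.measurable_act s)
  act_feasible t s := toLiquid_mem (d.act_feasible t s)

theorem IsSincere.toLiquid {i : Fin n} {d : Strategy M i} (h : IsSincere d) :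
    IsSincere d.toLiquid := fun c q s => by
  have := M.sincereBallot_isFor i c
  show (d.act _ s).toLiquid = .vote c
  rw [h]
  rcases this with h' | h' <;> rw [h'] <;> rfl

theorem performance_toLiquid (W : Criterion) (S : Profile M) :
    performance C W (fun i => (S i).toLiquid) = performance C W S := by
  have : ∀ (t : Fin n → VType) g, interimValue C (fun i => (S i).toLiquid.act (t i)) t g =
      interimValue C (fun i => (S i).act (t i)) t g := fun t g => by
    simp only [interimValue_eq, Strategy.toLiquid,
      winProb_toLiquid (fun j => (S j).act (t j) _)]
  cases W <;> simp only [performance, exAnteValue, this]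

end Sincere

/-! ### Ballot distributions -/

section Ballots

variable {n : ℕ} {M : Mechanism n} (C : Committee n)

/-- Probability that voter `i` chooses the ballot `b` in state `ω` under the strategy `d`. -/
noncomputable def ballotProb {i : Fin n} (d : Strategy M i) (ω : Alt) (b : Ballot n) : ℝ :=
  ∫ t, ∑ s, signalProb t ω s * (if d.act t s = b then 1 else 0) ∂(C.law i : Measure VType)

/-- The probability of the correct outcome as a function of the ballot distributions. -/
noncomputable def correctProb (X : Fin n → Alt → Ballot n → ℝ) : ℝ :=
  ∑ ω, C.stateProb ω * ∑ y : Fin n → Ballot n, (∏ j, X j ω (y j)) * winProb y ω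

/-- The sum of the products of the entries. -/
noncomputable def pairing (x c : Alt → Ballot n → ℝ) : ℝ := ∑ ω, ∑ b, x ω b * c ω b

/-- The coefficients of the linear map that `correctProb` is in the ballot distribution of voter
`i`. -/
noncomputable def influence (X : Fin n → Alt → Ballot n → ℝ) (i : Fin n) (ω : Alt)
    (b : Ballot n) : ℝ :=
  ∑ y : Fin n → Ballot n with y i = b,
    C.stateProb ω * ((∏ j ∈ Finset.univ.erase i, X j ω (y j)) * winProb y ω)

/-- The contribution of a type to a pairing. -/
noncomputable def typeValue (c : Alt → Ballot n → ℝ) (t : VType) (s : Alt) (b : Ballot n) : ℝ :=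
  ∑ ω, signalProb t ω s * c ω b

variable {C}

theorem measurable_act_indicator {i : Fin n} (d : Strategy M i) (s : Alt) (b : Ballot n) :
    Measurable fun t => if d.act t s = b then (1 : ℝ) else 0 :=
  (Measurable.of_discrete (f := fun b' => if b' = b then (1 : ℝ) else 0)).comp
    (d.measurable_act s)

theorem measurable_signalProb_mul {i : Fin n} (d : Strategy M i) (ω : Alt) (b : Ballot n) :
    Measurable fun t => ∑ s, signalProb t ω s * (if d.act t s = b then 1 else 0) :=
  Finset.measurable_sum _ fun s _ =>
    (measurable_signalProb ω s).mul (measurable_act_indicator d s b)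

theorem signalProb_mul_nonneg {i : Fin n} (d : Strategy M i) (ω : Alt) (b : Ballot n)
    (t : VType) : 0 ≤ ∑ s, signalProb t ω s * (if d.act t s = b then 1 else 0) :=
  Finset.sum_nonneg fun s _ => mul_nonneg (signalProb_nonneg _ _ _)
    (by split_ifs; exacts [zero_le_one, le_rfl])

theorem signalProb_mul_le_one {i : Fin n} (d : Strategy M i) (ω : Alt) (b : Ballot n)
    (t : VType) : ∑ s, signalProb t ω s * (if d.act t s = b then 1 else 0) ≤ 1 := by
  refine le_of_le_of_eq ?_ (sum_signalProb t ω)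
  exact Finset.sum_le_sum fun s _ =>
    mul_le_of_le_one_right (signalProb_nonneg _ _ _)
      (by split_ifs; exacts [le_rfl, zero_le_one])

theorem integrable_signalProb_mul {i : Fin n} (d : Strategy M i) (ω : Alt) (b : Ballot n) :
    Integrable (fun t => ∑ s, signalProb t ω s * (if d.act t s = b then 1 else 0))
      (C.law i : Measure VType) :=
  Integrable.of_bound (measurable_signalProb_mul d ω b).aestronglyMeasurable 1
    (Filter.Eventually.of_forall fun t => by
      rw [Real.norm_eq_abs, abs_of_nonneg (signalProb_mul_nonneg d ω b t)]
      exact signalProb_mul_le_one d ω b t)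

theorem ballotProb_nonneg {i : Fin n} (d : Strategy M i) (ω : Alt) (b : Ballot n) :
    0 ≤ ballotProb C d ω b :=
  integral_nonneg fun t => signalProb_mul_nonneg d ω b t

theorem ballotProb_le_one {i : Fin n} (d : Strategy M i) (ω : Alt) (b : Ballot n) :
    ballotProb C d ω b ≤ 1 := by
  refine (integral_mono (integrable_signalProb_mul d ω b) (integrable_const 1)
    (signalProb_mul_le_one d ω b)).trans ?_
  simp

theorem sum_signalWeight_mul_winProb (S : Profile M) (t : Fin n → VType) (ω : Alt) :
    ∑ s, signalWeight t ω s * winProb (fun j => (S j).act (t j) (s j)) ω =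
      ∑ y : Fin n → Ballot n, (∏ j, ∑ s, signalProb (t j) ω s *
        (if (S j).act (t j) s = y j then 1 else 0)) * winProb y ω := by
  have h : ∀ y : Fin n → Ballot n, ∏ j, ∑ s, signalProb (t j) ω s *
        (if (S j).act (t j) s = y j then (1 : ℝ) else 0) =
      ∑ s, signalWeight t ω s * (if (fun j => (S j).act (t j) (s j)) = y then 1 else 0) := by
    intro y
    rw [Finset.prod_univ_sum, Fintype.piFinset_univ]
    refine Finset.sum_congr rfl fun s _ => ?_
    rw [Finset.prod_mul_distrib, Finset.prod_ite_zero, signalWeight]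
    simp [funext_iff]
  simp only [h, Finset.sum_mul]
  rw [Finset.sum_comm]
  refine Finset.sum_congr rfl fun s _ => ?_
  simp

/-- Given the state, types and signals are independent across voters, so the ballot profile has a
product distribution. -/
theorem performance_eq_correctProb (S : Profile M) :
    performance C .informationAggregation S = correctProb C fun i => ballotProb C (S i) := by
  unfold performance exAnteValue correctProb
  simp only [interimValue_eq, sum_winProb_correct, sum_signalWeight_mul_winProb]
  have hint : ∀ (ω : Alt) (y : Fin n → Ballot n), Integrable (fun t : Fin n → VType =>
      (∏ j, ∑ s, signalProb (t j) ω s * (if (S j).act (t j) s = y j then 1 else 0)) *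
        winProb y ω) C.typeLaw := fun ω y =>
    (Integrable.fintype_prod_dep (f := fun j t => ∑ s, signalProb t ω s *
      (if (S j).act t s = y j then (1 : ℝ) else 0))
      fun j => integrable_signalProb_mul (S j) ω (y j)).mul_const _
  rw [integral_finsetSum _ fun ω _ => (integrable_finsetSum _ fun y _ => hint ω y).const_mul _]
  refine Finset.sum_congr rfl fun ω _ => ?_
  rw [integral_const_mul, integral_finsetSum _ fun y _ => hint ω y]
  congr 1
  refine Finset.sum_congr rfl fun y _ => ?_
  rw [integral_mul_const]
  congr 1
  exact integral_fintype_prod_eq_prod (fun j t => ∑ s, signalProb t ω s *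
      (if (S j).act t s = y j then (1 : ℝ) else 0))

theorem correctProb_update (X : Fin n → Alt → Ballot n → ℝ) (i : Fin n)
    (x : Alt → Ballot n → ℝ) :
    correctProb C (Function.update X i x) = pairing x (influence C X i) := by
  unfold correctProb pairing influence
  refine Finset.sum_congr rfl fun ω _ => ?_
  have h : ∀ b, x ω b * ∑ y : Fin n → Ballot n with y i = b,
        C.stateProb ω * ((∏ j ∈ Finset.univ.erase i, X j ω (y j)) * winProb y ω) =
      ∑ y : Fin n → Ballot n with y i = b, x ω (y i) *
        (C.stateProb ω * ((∏ j ∈ Finset.univ.erase i, X j ω (y j)) * winProb y ω)) := by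
    intro b
    rw [Finset.mul_sum]
    refine Finset.sum_congr rfl fun y hy => ?_
    rw [(Finset.mem_filter.1 hy).2]
  simp only [h]
  rw [Finset.sum_fiberwise, Finset.mul_sum]
  refine Finset.sum_congr rfl fun y _ => ?_
  rw [← Finset.mul_prod_erase _ _ (Finset.mem_univ i), Function.update_self,
    Finset.prod_congr rfl fun j hj => by rw [Function.update_of_ne (Finset.ne_of_mem_erase hj)]]
  ring

theorem ballotProb_update (S : Profile M) (i : Fin n) (d : Strategy M i) :
    (fun j => ballotProb C (Function.update S i d j)) =
      Function.update (fun j => ballotProb C (S j)) i (ballotProb C d) := by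
  funext j
  by_cases h : j = i
  · subst h; simp
  · simp [h]

theorem performance_update (S : Profile M) (i : Fin n) (d : Strategy M i) :
    performance C .informationAggregation (Function.update S i d) =
      pairing (ballotProb C d) (influence C (fun j => ballotProb C (S j)) i) := by
  rw [performance_eq_correctProb, ballotProb_update, correctProb_update]

theorem integrable_typeValue {i : Fin n} (d : Strategy M i) (c : Alt → Ballot n → ℝ) :
    Integrable (fun t => ∑ s, typeValue c t s (d.act t s)) (C.law i : Measure VType) := by
  unfold typeValue
  refine integrable_finsetSum _ fun s _ => integrable_finsetSum _ fun ω _ => ?_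
  obtain ⟨b₀, -, hb₀⟩ := Finset.exists_max_image Finset.univ (fun b => |c ω b|)
    ⟨Ballot.abstain, Finset.mem_univ _⟩
  refine Integrable.of_bound ((measurable_signalProb ω s).mul
    ((Measurable.of_discrete (f := c ω)).comp (d.measurable_act s))).aestronglyMeasurable
    (|c ω b₀|) (Filter.Eventually.of_forall fun t => ?_)
  rw [Real.norm_eq_abs, abs_mul, abs_of_nonneg (signalProb_nonneg _ _ _)]
  exact (mul_le_of_le_one_left (abs_nonneg _) (signalProb_le_one _ _ _)).trans
    (hb₀ _ (Finset.mem_univ _))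

/-- A linear objective thus separates over types and signals and can be maximized pointwise by a
pure strategy. -/
theorem pairing_ballotProb {i : Fin n} (d : Strategy M i) (c : Alt → Ballot n → ℝ) :
    pairing (ballotProb C d) c =
      ∫ t, ∑ s, typeValue c t s (d.act t s) ∂(C.law i : Measure VType) := by
  have h : ∀ t, ∑ s, typeValue c t s (d.act t s) =
      ∑ ω, ∑ b, (∑ s, signalProb t ω s * (if d.act t s = b then 1 else 0)) * c ω b := by
    intro t
    simp only [typeValue]
    rw [Finset.sum_comm]
    refine Finset.sum_congr rfl fun ω _ => ?_
    simp only [Finset.sum_mul]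
    rw [Finset.sum_comm]
    refine Finset.sum_congr rfl fun s _ => ?_
    simp
  simp only [h]
  rw [integral_finsetSum _ fun ω _ => integrable_finsetSum _ fun b _ =>
    (integrable_signalProb_mul d ω b).mul_const _]
  refine Finset.sum_congr rfl fun ω _ => ?_
  rw [integral_finsetSum _ fun b _ => (integrable_signalProb_mul d ω b).mul_const _]
  refine Finset.sum_congr rfl fun b _ => ?_
  rw [integral_mul_const]
  rfl

/-! ### Linearity and continuity -/

theorem pairing_add (x c c' : Alt → Ballot n → ℝ) :
    pairing x (c + c') = pairing x c + pairing x c' := by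
  simp [pairing, mul_add, Finset.sum_add_distrib]

theorem pairing_zero (x : Alt → Ballot n → ℝ) : pairing x 0 = 0 := by simp [pairing]

theorem pairing_smul (x c : Alt → Ballot n → ℝ) (r : ℝ) :
    pairing x (r • c) = r * pairing x c := by
  simp only [pairing, Pi.smul_apply, smul_eq_mul, Finset.mul_sum]
  exact Finset.sum_congr rfl fun ω _ => Finset.sum_congr rfl fun b _ => by ring

theorem pairing_sum (x : Alt → Ballot n → ℝ) (F : Finset (Alt → Ballot n → ℝ)) :
    pairing x (∑ c ∈ F, c) = ∑ c ∈ F, pairing x c := by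
  classical
  induction F using Finset.induction_on with
  | empty => simp [pairing_zero]
  | insert a F ha ih => rw [Finset.sum_insert ha, Finset.sum_insert ha, pairing_add, ih]

theorem continuous_pairing (c : Alt → Ballot n → ℝ) : Continuous fun x => pairing x c := by
  unfold pairing
  fun_prop

theorem continuous_correctProb : Continuous (correctProb C) := by
  unfold correctProb
  fun_prop

/-! ### Pointwise best strategies -/

theorem typeValue_convex (c : Alt → Ballot n → ℝ) (p : Pref) {q₁ q₂ q : Precision} {a b : ℝ}
    (hab : a + b = 1) (hq : (q : ℝ) = a * q₁ + b * q₂) (s : Alt) (y : Ballot n) :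
    typeValue c (p, q) s y = a * typeValue c (p, q₁) s y + b * typeValue c (p, q₂) s y := by
  obtain rfl : b = 1 - a := by linarith
  cases s <;> simp [typeValue, sum_alt, signalProb, hq] <;> ring

theorem eq_zero_of_convex {a b x y : ℝ} (ha : 0 < a) (hb : 0 < b) (hx : 0 ≤ x) (hy : 0 ≤ y)
    (h : a * x + b * y ≤ 0) : x = 0 ∧ y = 0 := by
  have h1 := mul_nonneg ha.le hx
  have h2 := mul_nonneg hb.le hy
  exact ⟨(mul_eq_zero.1 (by linarith : a * x = 0)).resolve_left ha.ne',
    (mul_eq_zero.1 (by linarith : b * y = 0)).resolve_left hb.ne'⟩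

/-- The lexicographic objective made of two values and an injective tie-breaking rule. -/
noncomputable def lexValue (c₁ c₂ : Alt → Ballot n → ℝ) (q : Precision) (s : Alt) (y : Ballot n) :
    ℝ ×ₗ (ℝ ×ₗ ℕ) :=
  toLex (typeValue c₁ (.independent, q) s y,
    toLex (typeValue c₂ (.independent, q) s y, (Fintype.equivFin (Ballot n) y : ℕ)))

theorem lexValue_le_iff {c₁ c₂ : Alt → Ballot n → ℝ} {q : Precision} {s : Alt}
    {y z : Ballot n} : lexValue c₁ c₂ q s y ≤ lexValue c₁ c₂ q s z ↔
      typeValue c₁ (.independent, q) s y < typeValue c₁ (.independent, q) s z ∨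
      typeValue c₁ (.independent, q) s y = typeValue c₁ (.independent, q) s z ∧
      (typeValue c₂ (.independent, q) s y < typeValue c₂ (.independent, q) s z ∨
      typeValue c₂ (.independent, q) s y = typeValue c₂ (.independent, q) s z ∧
      (Fintype.equivFin (Ballot n) y : ℕ) ≤ Fintype.equivFin (Ballot n) z) := by
  rw [lexValue, lexValue, Prod.Lex.le_iff]
  dsimp only [ofLex_toLex]
  rw [Prod.Lex.le_iff]
  rfl

/-- The difference of the first values of `y` and `z` is affine in the precision, nonnegative at
both ends and nonpositive in between, so it vanishes at both ends. The same then holds for the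
second values, and the injective index decides. -/
theorem lexValue_convex {c₁ c₂ : Alt → Ballot n → ℝ} {q₁ q q₂ : Precision} {s : Alt}
    {y z : Ballot n} (h₁ : lexValue c₁ c₂ q₁ s z ≤ lexValue c₁ c₂ q₁ s y)
    (h₂ : lexValue c₁ c₂ q₂ s z ≤ lexValue c₁ c₂ q₂ s y) (hlt₁ : q₁ < q) (hlt₂ : q < q₂)
    (h : lexValue c₁ c₂ q s y ≤ lexValue c₁ c₂ q s z) : z = y := by
  obtain ⟨a, b, ha, hb, hab, hq⟩ : ∃ a b : ℝ, 0 < a ∧ 0 < b ∧ a + b = 1 ∧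
      (q : ℝ) = a * q₁ + b * q₂ := by
    have : (q : ℝ) ∈ openSegment ℝ (q₁ : ℝ) q₂ := by
      rw [openSegment_eq_Ioo (lt_trans (Subtype.coe_lt_coe.2 hlt₁) (Subtype.coe_lt_coe.2 hlt₂))]
      exact ⟨hlt₁, hlt₂⟩
    obtain ⟨a, b, ha, hb, hab, hq⟩ := this
    exact ⟨a, b, ha, hb, hab, by simpa using hq.symm⟩
  rw [lexValue_le_iff] at h₁ h₂ h
  simp only [typeValue_convex _ _ hab hq] at h
  obtain ⟨e₁, e₂⟩ := eq_zero_of_convex ha hb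
    (x := typeValue c₁ (.independent, q₁) s y - typeValue c₁ (.independent, q₁) s z)
    (y := typeValue c₁ (.independent, q₂) s y - typeValue c₁ (.independent, q₂) s z)
    (by rcases h₁ with h | h <;> linarith) (by rcases h₂ with h | h <;> linarith)
    (by rcases h with h | h <;> linarith)
  rw [sub_eq_zero] at e₁ e₂
  simp only [e₁, e₂, lt_irrefl, false_or, true_and] at h₁ h₂ h
  obtain ⟨f₁, f₂⟩ := eq_zero_of_convex ha hb
    (x := typeValue c₂ (.independent, q₁) s y - typeValue c₂ (.independent, q₁) s z)
    (y := typeValue c₂ (.independent, q₂) s y - typeValue c₂ (.independent, q₂) s z)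
    (by rcases h₁ with h | h <;> linarith) (by rcases h₂ with h | h <;> linarith)
    (by rcases h with h | h <;> linarith)
  rw [sub_eq_zero] at f₁ f₂
  simp only [f₁, f₂, lt_irrefl, false_or, true_and] at h₁ h₂ h
  exact (Fintype.equivFin (Ballot n)).injective (Fin.ext (le_antisymm h₁ h))

/-- A sincere threshold strategy that is, for each type and signal, best for two linear
objectives considered lexicographically. -/
theorem exists_lexicographically_best (M : Mechanism n) (i : Fin n)
    (c₁ c₂ : Alt → Ballot n → ℝ) :
    ∃ d : Strategy M i, IsSincere d ∧ IsThreshold d ∧ ∀ d' : Strategy M i, IsSincere d' → ∀ t s,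
      typeValue c₁ t s (d'.act t s) < typeValue c₁ t s (d.act t s) ∨
      typeValue c₁ t s (d'.act t s) = typeValue c₁ t s (d.act t s) ∧
      typeValue c₂ t s (d'.act t s) ≤ typeValue c₂ t s (d.act t s) := by
  have hex : ∀ (q : Precision) (s : Alt), ∃ y ∈ M.feasible i, ∀ z ∈ M.feasible i,
      lexValue c₁ c₂ q s z ≤ lexValue c₁ c₂ q s y := fun q s =>
    Set.exists_max_image _ _ (Set.toFinite _) ⟨_, M.abstain_mem i⟩
  choose f hf hmax using hex
  have hord : ∀ s y, {q : Precision | f q s = y}.OrdConnected := fun s y => by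
    refine ⟨fun q₁ h₁ q₂ h₂ q hq => ?_⟩
    rcases hq.1.eq_or_lt with rfl | hlt₁
    · exact h₁
    rcases hq.2.eq_or_lt with rfl | hlt₂
    · exact h₂
    have e₁ := hmax q₁ s (f q s) (hf q s)
    have e₂ := hmax q₂ s (f q s) (hf q s)
    rw [Set.mem_ofPred_eq] at h₁ h₂
    rw [h₁] at e₁
    rw [h₂] at e₂
    exact lexValue_convex e₁ e₂ hlt₁ hlt₂ (hmax q s y (h₁ ▸ hf q₁ s))
  -- Measurability comes for free: the fibers of `f` over the finitely many ballots are
  -- order-connected, hence Borel.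
  refine ⟨sincereStrategy f (fun s => measurable_to_countable' fun y =>
    (hord s y).measurableSet) hf, fun _ _ _ => rfl, hord, ?_⟩
  rintro d' hd' ⟨p, q⟩ s
  cases p with
  | partisan c =>
    rw [hd' c q s]
    exact Or.inr ⟨rfl, le_rfl⟩
  | independent =>
    rcases lexValue_le_iff.1 (hmax q s _ (d'.act_feasible (.independent, q) s)) with h | ⟨h, h'⟩
    · exact Or.inl h
    · exact Or.inr ⟨h, h'.elim le_of_lt fun h' => h'.1.le⟩

end Ballots

section Existence

variable {n : ℕ} {M : Mechanism n} (C : Committee n)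

/-! ### Optimal sincere profiles -/

/-- The ballot distributions that sincere strategies induce. -/
def sincereBallotProbs (M : Mechanism n) (i : Fin n) : Set (Alt → Ballot n → ℝ) :=
  {x | ∃ d : Strategy M i, IsSincere d ∧ ballotProb C d = x}

variable {C}

/-- A pure strategy attains the maximum even over the closure, so the set of ballot distributions
need not be shown closed. -/
theorem exists_pairing_max (M : Mechanism n) (i : Fin n) (c : Alt → Ballot n → ℝ) :
    ∃ x ∈ sincereBallotProbs C M i, ∀ x' ∈ closure (sincereBallotProbs C M i),
      pairing x' c ≤ pairing x c := by
  obtain ⟨d, hd, -, hbest⟩ := exists_lexicographically_best M i c 0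
  refine ⟨_, ⟨d, hd, rfl⟩, fun x' hx' => ?_⟩
  refine closure_minimal (t := {x | pairing x c ≤ pairing (ballotProb C d) c}) ?_
    (isClosed_le (continuous_pairing c) continuous_const) hx'
  rintro _ ⟨d', hd', rfl⟩
  rw [Set.mem_ofPred_eq, pairing_ballotProb, pairing_ballotProb]
  exact integral_mono (integrable_typeValue d' c) (integrable_typeValue d c) fun t =>
    Finset.sum_le_sum fun s _ => (hbest d' hd' t s).elim le_of_lt fun h => h.1.le

theorem isCompact_closure_sincereBallotProbs (M : Mechanism n) :
    IsCompact (Set.univ.pi fun i => closure (sincereBallotProbs C M i)) := by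
  refine isCompact_univ_pi fun i => ?_
  refine (isCompact_Icc (a := (0 : Alt → Ballot n → ℝ)) (b := 1)).of_isClosed_subset
    isClosed_closure (closure_minimal ?_ isClosed_Icc)
  rintro _ ⟨d, -, rfl⟩
  exact ⟨fun ω b => ballotProb_nonneg d ω b, fun ω b => ballotProb_le_one d ω b⟩

/-- Starting from a maximizer in the compact closure, coordinates are replaced one at a time by
attained ones; by linearity in each coordinate the value does not drop. -/
theorem exists_correctProb_max (C : Committee n) (M : Mechanism n) (s : Finset (Fin n)) :
    ∃ X ∈ Set.univ.pi fun i => closure (sincereBallotProbs C M i),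
      (∀ X' ∈ Set.univ.pi fun i => closure (sincereBallotProbs C M i),
        correctProb C X' ≤ correctProb C X) ∧ ∀ i ∈ s, X i ∈ sincereBallotProbs C M i := by
  induction s using Finset.induction_on with
  | empty =>
    obtain ⟨X, hX, hmax⟩ := (isCompact_closure_sincereBallotProbs (C := C) M).exists_isMaxOn
      (Set.univ_pi_nonempty_iff.2 fun i => by
        obtain ⟨x, hx, -⟩ := exists_pairing_max (C := C) M i 0
        exact ⟨x, subset_closure hx⟩) continuous_correctProb.continuousOn
    exact ⟨X, hX, fun X' hX' => hmax hX', by simp⟩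
  | insert i s _ ih =>
    obtain ⟨X, hX, hmax, hs⟩ := ih
    obtain ⟨x, hx, hbest⟩ := exists_pairing_max (C := C) M i (influence C X i)
    refine ⟨Function.update X i x, fun j _ => ?_, fun X' hX' => (hmax X' hX').trans ?_, ?_⟩
    · by_cases h : j = i
      · subst h
        simpa using subset_closure hx
      · simpa [h] using hX j trivial
    · have := hbest (X i) (hX i trivial)
      rwa [← correctProb_update, ← correctProb_update, Function.update_eq_self] at this
    · intro j hj
      by_cases h : j = i
      · subst h
        simpa using hx
      · simpa [h] using hs j (Finset.mem_of_mem_insert_of_ne hj h)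

/-- A sincere profile that maximizes the probability of the correct outcome among all sincere
profiles. -/
def IsOptimal (C : Committee n) (S : Profile M) : Prop :=
  (∀ i, IsSincere (S i)) ∧ ∀ S' : Profile M, (∀ i, IsSincere (S' i)) →
    performance C .informationAggregation S' ≤ performance C .informationAggregation S

theorem exists_isOptimal (C : Committee n) (M : Mechanism n) :
    ∃ S : Profile M, IsOptimal C S := by
  obtain ⟨X, -, hmax, hX⟩ := exists_correctProb_max C M Finset.univ
  choose S hS hSX using fun i => hX i (Finset.mem_univ i)
  refine ⟨S, hS, fun S' hS' => ?_⟩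
  rw [performance_eq_correctProb, performance_eq_correctProb, funext hSX]
  exact hmax _ fun i _ => subset_closure ⟨S' i, hS' i, rfl⟩

/-! ### Undominated responses -/

/-- No loss in the integral of the first objective forces pointwise ties almost everywhere, where
the second objective decides. -/
theorem pairing_le_of_typeValue {i : Fin n} {d d' : Strategy M i} {c₁ c₂ : Alt → Ballot n → ℝ}
    (hbest : ∀ t s, typeValue c₁ t s (d'.act t s) < typeValue c₁ t s (d.act t s) ∨
      typeValue c₁ t s (d'.act t s) = typeValue c₁ t s (d.act t s) ∧
      typeValue c₂ t s (d'.act t s) ≤ typeValue c₂ t s (d.act t s))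
    (h : pairing (ballotProb C d) c₁ ≤ pairing (ballotProb C d') c₁) :
    pairing (ballotProb C d') c₂ ≤ pairing (ballotProb C d) c₂ := by
  have hle : ∀ t s, typeValue c₁ t s (d'.act t s) ≤ typeValue c₁ t s (d.act t s) := fun t s =>
    (hbest t s).elim le_of_lt fun h => h.1.le
  have hsum : ∀ t, ∑ s, typeValue c₁ t s (d'.act t s) ≤ ∑ s, typeValue c₁ t s (d.act t s) :=
    fun t => Finset.sum_le_sum fun s _ => hle t s
  rw [pairing_ballotProb, pairing_ballotProb] at h
  have hae := (integral_eq_iff_of_ae_le (integrable_typeValue d' c₁) (integrable_typeValue d c₁)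
    (Filter.Eventually.of_forall hsum)).1 (le_antisymm (integral_mono
      (integrable_typeValue d' c₁) (integrable_typeValue d c₁) hsum) h)
  rw [pairing_ballotProb, pairing_ballotProb]
  refine integral_mono_ae (integrable_typeValue d' c₂) (integrable_typeValue d c₂) ?_
  filter_upwards [hae] with t ht
  refine Finset.sum_le_sum fun s _ => ?_
  have := (Finset.sum_eq_sum_iff_of_le fun s _ => hle t s).1 ht s (Finset.mem_univ s)
  exact (hbest t s).elim (fun h => absurd this h.ne) fun h => h.2

/-- Every voter has an undominated sincere threshold strategy that is optimal against the others
among the sincere strategies. -/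
theorem exists_undominated_response (S : Profile M) (i : Fin n) :
    ∃ d : Strategy M i, IsSincere d ∧ IsThreshold d ∧ (¬ ∃ d', WeaklyDominates C d' d) ∧
      ∀ d' : Strategy M i, IsSincere d' →
        performance C .informationAggregation (Function.update S i d') ≤
          performance C .informationAggregation (Function.update S i d) := by
  set c : Profile M → Alt → Ballot n → ℝ :=
    fun S' => influence C (fun j => ballotProb C (S' j)) i
  -- The influences of all profiles lie in a finite-dimensional space, so finitely many of them span
  -- the rest; their sum serves as tie-breaker.
  obtain ⟨F, hF, hspan⟩ := (Submodule.fg_span_iff_fg_span_finset_subset (R := ℝ)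
    (Set.range c)).1 (IsNoetherian.noetherian _)
  obtain ⟨d, hd, hthr, hbest⟩ := exists_lexicographically_best M i (c S) (∑ x ∈ F, x)
  refine ⟨d, hd, hthr, ?_, fun d' hd' => ?_⟩
  · rintro ⟨d', hdom, S₀, hlt⟩
    have he := isSincere_sincerify d'
    have hge : ∀ S' : Profile M,
        pairing (ballotProb C d) (c S') ≤ pairing (ballotProb C (sincerify d')) (c S') := by
      intro S'
      have h1 := (hdom S').trans (EU_le_sincerify C S' i d')
      have h2 := EU_sub_EU_of_isSincere C S' i hd he
      rw [performance_update, performance_update] at h2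
      linarith
    have hsum := pairing_le_of_typeValue (hbest _ he) (hge S)
    rw [pairing_sum, pairing_sum] at hsum
    have hFle : ∀ x ∈ F, pairing (ballotProb C d) x ≤ pairing (ballotProb C (sincerify d')) x := by
      intro x hx
      obtain ⟨S', rfl⟩ := hF hx
      exact hge S'
    -- A dominating strategy does at least as well on each member of `F` but no better on the sum,
    -- hence equally on each, on the span, and against `S₀`.
    have hFeq := (Finset.sum_eq_sum_iff_of_le hFle).1 (le_antisymm (Finset.sum_le_sum hFle) hsum)
    have hall : ∀ x ∈ Submodule.span ℝ (F : Set (Alt → Ballot n → ℝ)),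
        pairing (ballotProb C d) x = pairing (ballotProb C (sincerify d')) x := by
      intro x hx
      induction hx using Submodule.span_induction with
      | mem x hx => exact hFeq x hx
      | zero => rw [pairing_zero, pairing_zero]
      | add x y _ _ hx hy => rw [pairing_add, pairing_add, hx, hy]
      | smul r x _ hx => rw [pairing_smul, pairing_smul, hx]
    have h0 := hall (c S₀) (hspan ▸ Submodule.subset_span ⟨S₀, rfl⟩)
    have h2 := EU_sub_EU_of_isSincere C S₀ i hd he
    rw [performance_update, performance_update] at h2
    have h3 := EU_le_sincerify C S₀ i d'
    linarith
  · rw [performance_update, performance_update, pairing_ballotProb, pairing_ballotProb]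
    exact integral_mono (integrable_typeValue d' _) (integrable_typeValue d _) fun t =>
      Finset.sum_le_sum fun s _ => (hbest d' hd' t s).elim le_of_lt fun h => h.1.le

theorem IsOptimal.update {S : Profile M} (hS : IsOptimal C S) {i : Fin n} {d : Strategy M i}
    (hd : IsSincere d) (hbest : ∀ d' : Strategy M i, IsSincere d' →
      performance C .informationAggregation (Function.update S i d') ≤
        performance C .informationAggregation (Function.update S i d)) :
    IsOptimal C (Function.update S i d) := by
  refine ⟨fun j => ?_, fun S' hS' => (hS.2 S' hS').trans ?_⟩
  · by_cases h : j = i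
    · subst h
      simpa using hd
    · simpa [h] using hS.1 j
  · have := hbest (S i) (hS.1 i)
    rwa [Function.update_eq_self] at this

/-- Voters can be treated one after another: a best sincere response preserves optimality, and the
two properties concern a voter's own strategy only, so later replacements keep them. -/
theorem exists_isOptimal_undominated (C : Committee n) (M : Mechanism n) (s : Finset (Fin n)) :
    ∃ S : Profile M, IsOptimal C S ∧
      ∀ i ∈ s, IsThreshold (S i) ∧ ¬ ∃ d, WeaklyDominates C d (S i) := by
  induction s using Finset.induction_on with
  | empty =>
    obtain ⟨S, hS⟩ := exists_isOptimal C M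
    exact ⟨S, hS, by simp⟩
  | insert i s _ ih =>
    obtain ⟨S, hS, hs⟩ := ih
    obtain ⟨d, hd, hthr, hdom, hbest⟩ := exists_undominated_response (C := C) S i
    refine ⟨Function.update S i d, hS.update hd hbest, fun j hj => ?_⟩
    by_cases h : j = i
    · subst h
      simpa using ⟨hthr, not_exists.1 hdom⟩
    · simpa [h] using hs j (Finset.mem_of_mem_insert_of_ne hj h)

theorem IsOptimal.isBayesNash {S : Profile M} (hS : IsOptimal C S) : IsBayesNash C S := by
  intro i d
  have he := isSincere_sincerify d
  have h1 := EU_le_sincerify C S i d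
  have h2 := EU_sub_EU_of_isSincere C S i (hS.1 i) he
  have h3 := hS.2 (Function.update S i (sincerify d)) fun j => by
    by_cases h : j = i
    · subst h
      simpa using he
    · simpa [h] using hS.1 j
  rw [Function.update_eq_self] at h2
  linarith

/-! ### Best equilibria and comparison of the voting systems -/

theorem IsOptimal.performance_le {S : Profile M} (hS : IsOptimal C S) (W : Criterion)
    {S' : Profile M} (hS' : ∀ i, IsSincere (S' i)) : performance C W S' ≤ performance C W S := by
  have := hS.2 S' hS'
  cases W with
  | informationAggregation => exact this
  | welfare =>
    rw [performance_welfare C hS', performance_welfare C hS.1]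
    linarith

theorem exists_isEquilibrium_isOptimal (C : Committee n) (M : Mechanism n) :
    ∃ S : Profile M, IsEquilibrium C S ∧ IsOptimal C S := by
  obtain ⟨S, hS, h⟩ := exists_isOptimal_undominated C M Finset.univ
  exact ⟨S, ⟨hS.isBayesNash, fun i => (h i (Finset.mem_univ i)).2,
    fun i => (h i (Finset.mem_univ i)).1⟩, hS⟩

theorem exists_isBestEquilibrium (C : Committee n) (M : Mechanism n) :
    ∃ S : Profile M, ∀ W, IsBestEquilibrium C W S := by
  obtain ⟨S, hS, hopt⟩ := exists_isEquilibrium_isOptimal C M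
  refine ⟨S, fun W => ⟨hS, fun S' hS' => ?_⟩⟩
  rw [← performance_sincerify C hS' W]
  exact hopt.performance_le W fun i => isSincere_sincerify (S' i)

/-- The copied profile need not be an equilibrium of liquid democracy; it only has to be sincere to
be bounded by the optimum. -/
theorem performance_le_liquid {W : Criterion} {SL : Profile (Mechanism.liquid (n := n))}
    (hSL : IsBestEquilibrium C W SL) {S : Profile M} (hS : IsEquilibrium C S) :
    performance C W S ≤ performance C W SL := by
  obtain ⟨S₁, hS₁, hopt⟩ := exists_isEquilibrium_isOptimal C (Mechanism.liquid (n := n))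
  refine le_trans ?_ (hSL.2 S₁ hS₁)
  rw [← performance_sincerify C hS W, ← performance_toLiquid]
  exact hopt.performance_le W fun i => (isSincere_sincerify (S i)).toLiquid

end Existence

end LiquidDemocracy

open LiquidDemocracy
theorem mainTheorem1 {n : ℕ} (C : Committee n) :
    (∃ S : Profile (Mechanism.liquid (n := n)), ∀ W, IsBestEquilibrium C W S) ∧
    (∃ S : Profile (Mechanism.direct (n := n)), ∀ W, IsBestEquilibrium C W S) ∧
    (∀ J : Finset (Fin n),
      ∃ S : Profile (Mechanism.representative J), ∀ W, IsBestEquilibrium C W S) ∧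
    ∀ (W : Criterion) (SL : Profile (Mechanism.liquid (n := n))), IsBestEquilibrium C W SL →
      (∀ SD : Profile (Mechanism.direct (n := n)), IsBestEquilibrium C W SD →
        performance C W SD ≤ performance C W SL) ∧
      (∀ (J : Finset (Fin n)) (SR : Profile (Mechanism.representative J)),
        IsBestEquilibrium C W SR → performance C W SR ≤ performance C W SL) :=
  ⟨exists_isBestEquilibrium C _, exists_isBestEquilibrium C _,
    fun _ => exists_isBestEquilibrium C _, fun _ _ hSL =>
      ⟨fun _ hSD => performance_le_liquid hSL hSD.1,
        fun _ _ hSR => performance_le_liquid hSL hSR.1⟩⟩
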